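/- Let $p$ be an odd prime, let $\zeta_{p^2}$ be a primitive $p^2$-th root of unity and $\sqrt[p]{p}$ a $p$-th root of $p$ in an algebraic closure of $\mathbb{Q}_p$, and put $\pi=\zeta_{p^2}-1$. Let $b_k=\frac{(-1)^{k+1}}{k+1}$ for $k\ge 1$, and define rational numbers $B_n$ by $B_0=1$ and $B_n=\sum_{k=1}^{n} b_k B_{n-k}$ for $n\ge 1$. Then \[ \pi^{-2p+3}\left(\sqrt[p]{p}+\sum_{t=0}^{p-2}B_t\,\pi^{t+p-1}\right) \] is a uniformizer of the field $\mathbb{Q}_p(\zeta_{p^2},\sqrt[p]{p})$. -/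

import Mathlib

open scoped NNReal

/-- The rational numbers `b_k = (-1)^(k+1) / (k+1)`. -/
def coeffb (k : ℕ) : ℚ := (-1) ^ (k + 1) / ((k : ℚ) + 1)

/-- The rational numbers `B_n` defined by `B_0 = 1` and `B_n = ∑_{k=1}^n b_k B_{n-k}` for `n ≥ 1`
(the recursive clause below is this sum with `k = i + 1`; see `coeffB_eq_sum`). -/
def coeffB : ℕ → ℚ
  | 0 => 1
  | n + 1 => ∑ i : Fin (n + 1), coeffb (i + 1) * coeffB (n - i)

theorem coeffB_zero : coeffB 0 = 1 := by
  rw [coeffB]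

theorem coeffB_eq_sum (n : ℕ) (hn : 1 ≤ n) :
    coeffB n = ∑ k ∈ Finset.Icc 1 n, coeffb k * coeffB (n - k) := by
  obtain ⟨m, rfl⟩ : ∃ m, n = m + 1 := ⟨n - 1, by omega⟩
  rw [coeffB, Fin.sum_univ_eq_sum_range (fun i => coeffb (i + 1) * coeffB (m - i)) (m + 1)]
  refine Finset.sum_nbij' (fun i => i + 1) (fun k => k - 1) ?_ ?_ ?_ ?_ ?_
  · intro i hi
    simp only [Finset.mem_range, Finset.mem_Icc] at hi ⊢
    omega
  · intro k hk
    simp only [Finset.mem_range, Finset.mem_Icc] at hk ⊢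
    omega
  · intro i _
    simp
  · intro k hk
    simp only [Finset.mem_Icc] at hk
    omega
  · intro i _
    rw [Nat.add_sub_add_right]

/-- The restriction to a subfield `K` of the algebraic closure of `ℚ_p` of the `p`-adic valuation
(written multiplicatively, with value `‖x‖` at `x`, where `‖·‖` extends the `p`-adic norm). -/
noncomputable def padicValuationOn {p : ℕ} [Fact p.Prime]
    (K : IntermediateField ℚ_[p] (PadicAlgCl p)) : Valuation K ℝ≥0 :=
  (Valued.v : Valuation (PadicAlgCl p) ℝ≥0).comap (algebraMap K (PadicAlgCl p))

/-- `x` is a uniformizer of `K`: it lies in `K`, the `p`-adic valuation on `K` is discrete, and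
the value of `x` is the generator below `1` of the value group. -/
def IsUniformizerOf {p : ℕ} [Fact p.Prime]
    (K : IntermediateField ℚ_[p] (PadicAlgCl p)) (x : PadicAlgCl p) : Prop :=
  ∃ (hx : x ∈ K) (_ : (padicValuationOn K).IsRankOneDiscrete),
    (padicValuationOn K).IsUniformizer ⟨x, hx⟩

/-! Put `π = ζ - 1`, `l = ζ ^ p - 1`, `q(x) = ((1 + x) ^ p - 1 - x ^ p) / (p x)`, and let `S` and
`B` be the sums of `coeffB t * x ^ t` over `t < p - 1` at `x = π` and `x = l`. Since `ζ ^ p` is a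
primitive `p`-th root of unity, `l ^ (p - 1) = -p q(l)`. Modulo `p`, `q` is the truncation of `log
(1 + X) / X`, whose inverse series has coefficients `coeffB`, so `p + B l ^ (p - 1)` vanishes modulo
`p ^ 2`. Substituting `l = π ^ p + p π q(π)` and `B ≡ S ^ p` modulo `p` gives
`exists_add_pow_eq_of_convolution_inverse`: `p + (π ^ (p - 1) S) ^ p` is `p π ^ (p (p - 2) + 1)`
times a unit, modulo `p ^ 2`. As `α ^ p = p`, this yields the norm of `α + π ^ (p - 1) S`; the power
`π ^ (-2 p + 3)` scales it so that its `p`-th power is `‖π‖` (`norm_pow_uniformizer`). Hence the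
element has norm `p ^ (-1 / n)` with `n = p ^ 2 (p - 1)`. The field has degree at most `n`, so this
norm generates its value group (`isUniformizerOf_of_norm_pow_eq`). -/

/-! ### Congruences in commutative rings. -/

open Finset in
/-- If two sequences are inverse to each other under convolution below `m`, then the product of
their truncated generating sums is `1` modulo `x ^ m`. -/
theorem pow_dvd_sum_mul_sum_sub_one {R : Type*} [CommRing R] (m : ℕ) (a b : ℕ → R) (x : R)
    (hab : ∀ d < m, ∑ ij ∈ HasAntidiagonal.antidiagonal d, a ij.1 * b ij.2 = if d = 0 then 1 else 0) :
    x ^ m ∣ (∑ i ∈ range m, a i * x ^ i) * (∑ i ∈ range m, b i * x ^ i) - 1 := by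
  have key : (Polynomial.X : Polynomial R) ^ m ∣
      (∑ i ∈ range m, Polynomial.C (a i) * Polynomial.X ^ i) *
        (∑ i ∈ range m, Polynomial.C (b i) * Polynomial.X ^ i) - 1 := by
    rw [Polynomial.X_pow_dvd_iff]
    intro d hd
    have hc : ∀ c : ℕ → R, ∀ i ≤ d,
        (∑ i ∈ range m, Polynomial.C (c i) * Polynomial.X ^ i).coeff i = c i := by
      intro c i hi
      simp [Polynomial.finsetSum_coeff, Polynomial.coeff_C_mul, Polynomial.coeff_X_pow,
        hi.trans_lt hd]
    rw [Polynomial.coeff_sub, Polynomial.coeff_mul, Polynomial.coeff_one, ← hab d hd, sub_eq_zero]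
    refine sum_congr rfl fun ij hij => ?_
    rw [Finset.HasAntidiagonal.mem_antidiagonal] at hij
    rw [hc a _ (by omega), hc b _ (by omega)]
  have := map_dvd (Polynomial.evalRingHom x) key
  simpa [Polynomial.eval_finsetSum] using this

theorem Nat.Prime.dvd_sum_pow_sub_sum_pow {R ι : Type*} [CommRing R] {p : ℕ} (hp : p.Prime)
    (s : Finset ι) (f : ι → R) : (p : R) ∣ (∑ i ∈ s, f i) ^ p - ∑ i ∈ s, f i ^ p := by
  classical
  induction s using Finset.induction_on with
  | empty => simp [hp.ne_zero]
  | insert i s hi ih =>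
    rw [Finset.sum_insert hi, Finset.sum_insert hi]
    obtain ⟨r, hr⟩ := exists_add_pow_prime_eq hp (f i) (∑ j ∈ s, f j)
    obtain ⟨t, ht⟩ := ih
    refine ⟨f i * (∑ j ∈ s, f j) * r + t, ?_⟩
    rw [hr]
    linear_combination ht

/-- The polynomial `((1 + x) ^ p - 1 - x ^ p) / (p x)`, evaluated at `x`. -/
def reducedBinomialSum {R : Type*} [CommRing R] (p : ℕ) (x : R) : R :=
  ∑ k ∈ Finset.range (p - 1), ((p.choose (k + 1) / p : ℕ) : R) * x ^ k

theorem Nat.Prime.one_add_pow_eq_reducedBinomialSum {R : Type*} [CommRing R] {p : ℕ}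
    (hp : p.Prime) (x : R) :
    (1 + x) ^ p = 1 + x ^ p + p * x * reducedBinomialSum p x := by
  obtain ⟨m, rfl⟩ : ∃ m, p = m + 1 := ⟨p - 1, by have := hp.pos; omega⟩
  rw [add_comm, add_pow, Finset.sum_range_succ, Finset.sum_range_succ', reducedBinomialSum,
    Finset.mul_sum]
  simp only [one_pow, mul_one, Nat.choose_self, Nat.cast_one, pow_zero, Nat.choose_zero_right,
    Nat.add_sub_cancel]
  have : ∀ k ∈ Finset.range m, x ^ (k + 1) * ((m + 1).choose (k + 1) : R) =
      ((m + 1 : ℕ) : R) * x * ((((m + 1).choose (k + 1) / (m + 1) : ℕ) : R) * x ^ k) := by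
    intro k hk
    rw [Finset.mem_range] at hk
    have h := Nat.mul_div_cancel' (hp.dvd_choose_self (k := k + 1) (by omega) (by omega))
    conv_lhs => rw [← h]
    rw [Nat.cast_mul]
    ring
  rw [Finset.sum_congr rfl this]
  ring

theorem Nat.Prime.dvd_reducedBinomialSum_sub_one {R : Type*} [CommRing R] {p : ℕ}
    (hp : p.Prime) (x : R) : x ∣ reducedBinomialSum p x - 1 := by
  obtain ⟨m, rfl⟩ : ∃ m, p = m + 2 := ⟨p - 2, by have := hp.two_le; omega⟩
  rw [reducedBinomialSum, show m + 2 - 1 = m + 1 by omega, Finset.sum_range_succ']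
  simp only [zero_add, Nat.choose_one_right, pow_zero, mul_one,
    Nat.div_self (show 0 < m + 2 by omega), Nat.cast_one, add_sub_cancel_right]
  exact Finset.dvd_sum fun i _ => Dvd.intro_left _ (by rw [pow_succ, ← mul_assoc])

theorem dvd_sum_mul_pow_sub_zero_coeff {R : Type*} [CommRing R] (b : ℕ → R) (x : R) {m : ℕ}
    (hm : 0 < m) : x ∣ ∑ t ∈ Finset.range m, b t * x ^ t - b 0 := by
  obtain ⟨m, rfl⟩ : ∃ n, m = n + 1 := ⟨m - 1, by omega⟩
  rw [Finset.sum_range_succ']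
  simp only [pow_zero, mul_one, add_sub_cancel_right]
  exact Finset.dvd_sum fun i _ => Dvd.intro_left _ (by rw [pow_succ, ← mul_assoc])

theorem Nat.Prime.pow_pred_eq_of_one_add_pow_eq_one {R : Type*} [CommRing R] [IsDomain R] {p : ℕ}
    (hp : p.Prime) {l : R} (hl : l ≠ 0) (h : (1 + l) ^ p = 1) :
    l ^ (p - 1) = -(p * reducedBinomialSum p l) := by
  rw [hp.one_add_pow_eq_reducedBinomialSum] at h
  apply mul_left_cancel₀ hl
  rw [← _root_.pow_succ', Nat.sub_add_cancel hp.one_le]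
  linear_combination h

/-- The key congruence modulo `p ^ 2`: here `1 + x` plays the role of a primitive `p ^ 2`-th root
of unity. -/
theorem exists_add_pow_eq_of_convolution_inverse {R : Type*} [CommRing R] [IsDomain R] {p : ℕ}
    (hp : p.Prime) (hp2 : 2 < p) (x : R) (a b : ℕ → R)
    (hab : ∀ d < p - 1,
      ∑ ij ∈ Finset.HasAntidiagonal.antidiagonal d, a ij.1 * b ij.2 = if d = 0 then 1 else 0)
    (ha : ∀ j < p - 1, (p : R) ∣ ((p.choose (j + 1) / p : ℕ) : R) - a j)
    (hb : ∀ j < p - 1, (p : R) ∣ b j ^ p - b j) (hb0 : b 0 = 1)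
    (hx : (p : R) ∣ x ^ (p * (p - 1)))
    (h1 : (1 + x) ^ p ≠ 1) (h2 : (1 + x) ^ (p ^ 2) = 1) :
    ∃ s u : R, (p : R) + (x ^ (p - 1) * ∑ t ∈ Finset.range (p - 1), b t * x ^ t) ^ p =
      p * x ^ (p * (p - 2) + 1) * (1 + x * u) + p ^ 2 * s := by
  -- `l` plays the role of `ζ_p - 1`.
  obtain ⟨l, hl⟩ : ∃ l, l = (1 + x) ^ p - 1 := ⟨_, rfl⟩
  have hl0 : l ≠ 0 := by rw [hl]; exact sub_ne_zero.mpr h1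
  have hl1 : (1 + l) ^ p = 1 := by
    rw [hl, add_sub_cancel, ← pow_mul, ← sq, h2]
  have hlx : l = x ^ p + p * x * reducedBinomialSum p x := by
    rw [hl, hp.one_add_pow_eq_reducedBinomialSum]; ring
  have hlp := hp.pow_pred_eq_of_one_add_pow_eq_one hl0 hl1
  have hdl : (p : R) ∣ l ^ (p - 1) := by
    rw [hlp, dvd_neg]; exact dvd_mul_right _ _
  obtain ⟨B, hB⟩ : ∃ B, B = ∑ t ∈ Finset.range (p - 1), b t * l ^ t := ⟨_, rfl⟩
  obtain ⟨S, hS⟩ : ∃ S, S = ∑ t ∈ Finset.range (p - 1), b t * x ^ t := ⟨_, rfl⟩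
  -- The truncated series are inverse modulo `l ^ (p - 1)`, which `p` divides.
  obtain ⟨s1, hs1⟩ : (p : R) ∣ reducedBinomialSum p l * B - 1 := by
    have e1 : (p : R) ∣ (∑ i ∈ Finset.range (p - 1), a i * l ^ i) * B - 1 := by
      rw [hB]; exact hdl.trans (pow_dvd_sum_mul_sum_sub_one _ a b l hab)
    have e2 : (p : R) ∣ reducedBinomialSum p l - ∑ i ∈ Finset.range (p - 1), a i * l ^ i := by
      rw [reducedBinomialSum, ← Finset.sum_sub_distrib]
      refine Finset.dvd_sum fun i hi => ?_
      rw [← sub_mul]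
      exact (ha i (Finset.mem_range.mp hi)).mul_right _
    have := dvd_add (e2.mul_right B) e1
    convert this using 1
    ring
  -- Frobenius modulo `p`: `l ≡ x ^ p` and `b t ^ p ≡ b t`.
  obtain ⟨s3, hs3⟩ : (p : R) ∣ B - S ^ p := by
    have e1 := hp.dvd_sum_pow_sub_sum_pow (Finset.range (p - 1)) fun t => b t * x ^ t
    rw [← hS] at e1
    have e2 : (p : R) ∣ B - ∑ t ∈ Finset.range (p - 1), (b t * x ^ t) ^ p := by
      rw [hB, ← Finset.sum_sub_distrib]
      refine Finset.dvd_sum fun t ht => ?_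
      have f1 := hb t (Finset.mem_range.mp ht)
      have f2 : (p : R) ∣ l ^ t - (x ^ p) ^ t := by
        refine dvd_trans ?_ (sub_dvd_pow_sub_pow l (x ^ p) t)
        rw [hlx, add_sub_cancel_left, mul_assoc]
        exact dvd_mul_right _ _
      have := dvd_sub (f2.mul_left (b t)) (f1.mul_right ((x ^ p) ^ t))
      convert this using 1
      rw [mul_pow, pow_right_comm]
      ring
    have := dvd_sub e2 e1
    convert this using 1
    ring
  obtain ⟨s2, hs2⟩ := Polynomial.powAddExpansion (x ^ p) (p * x * reducedBinomialSum p x) (p - 1)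
  rw [← hlx] at hs2
  obtain ⟨y, hy⟩ := hx
  obtain ⟨v, hv⟩ := hp.dvd_reducedBinomialSum_sub_one x
  obtain ⟨u, hu⟩ : x ∣ B - 1 := by
    have e := dvd_sum_mul_pow_sub_zero_coeff b l (m := p - 1) (by omega)
    rw [← hB, hb0] at e
    refine dvd_trans ?_ e
    rw [hlx]
    exact dvd_add (dvd_pow_self _ hp.ne_zero) ((dvd_mul_left x _).mul_right _)
  obtain ⟨V, hV⟩ : ∃ V, V = reducedBinomialSum p x := ⟨_, rfl⟩
  obtain ⟨q, hq⟩ : ∃ q, q = reducedBinomialSum p l := ⟨_, rfl⟩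
  obtain ⟨E, hE⟩ : ∃ E, E = x ^ (p * (p - 2)) := ⟨_, rfl⟩
  have hc : ((p - 1 : ℕ) : R) = p - 1 := by
    rw [Nat.cast_sub hp.one_le, Nat.cast_one]
  rw [hlp, hc, ← pow_mul, hy, ← pow_mul, show p - 1 - 1 = p - 2 by omega] at hs2
  rw [← hS, mul_pow, ← pow_mul, mul_comm (p - 1) p, hy, pow_succ]
  rw [← hV] at hs2 hv
  rw [← hq] at hs2 hs1
  rw [← hE] at hs2 ⊢
  have hVB : V * B = 1 + x * (v + u + x * (v * u)) := by
    linear_combination B * hv + hu + x * v * hu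
  -- The first term of `s` absorbs the `p` in the binomial factor `p - 1`; its `-1` gives the main
  -- term.
  refine ⟨-(E * x * V * B) - s2 * (x * V) ^ 2 * B - y * s3 - s1, v + u + x * (v * u), ?_⟩
  rw [← hVB]
  linear_combination (-B) * hs2 - (p : R) * y * hs3 - (p : R) * hs1

/-! ### The coefficients and their `p`-integrality. -/

/-- Since `-coeffb 0 = 1`, the recursion says that `coeffB` lists the coefficients of `X / log (1 +
X)`. -/
theorem sum_antidiagonal_neg_coeffb_mul_coeffB (d : ℕ) :
    ∑ ij ∈ Finset.HasAntidiagonal.antidiagonal d, -coeffb ij.1 * coeffB ij.2 =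
      if d = 0 then 1 else 0 := by
  rw [Finset.Nat.sum_antidiagonal_eq_sum_range_succ (fun i j => -coeffb i * coeffB j)]
  rcases Nat.eq_zero_or_pos d with rfl | hd
  · simp [coeffb, coeffB_zero]
  · rw [if_neg hd.ne', Finset.sum_range_succ']
    have h := coeffB_eq_sum d hd
    rw [← Finset.Ico_add_one_right_eq_Icc, Finset.sum_Ico_eq_sum_range] at h
    simp only [Nat.add_sub_cancel, add_comm 1] at h
    simp only [neg_mul, Finset.sum_neg_distrib, ← h]
    simp [coeffb]

section

variable {p : ℕ} [Fact p.Prime]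

theorem padic_norm_coeffb_le_one {j : ℕ} (hj : j < p - 1) : ‖((coeffb j : ℚ) : ℚ_[p])‖ ≤ 1 := by
  have h : ‖((j + 1 : ℕ) : ℚ_[p])‖ = 1 := by
    rw [Padic.norm_natCast_eq_one_iff]
    exact Nat.coprime_of_lt_prime (by omega) (by omega) Fact.out
  rw [coeffb]
  push_cast at h ⊢
  rw [norm_div, norm_pow, norm_neg, norm_one, one_pow, h, div_one]

theorem padic_norm_coeffB_le_one {j : ℕ} (hj : j < p - 1) : ‖((coeffB j : ℚ) : ℚ_[p])‖ ≤ 1 := by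
  induction j using Nat.strong_induction_on with
  | _ j ih =>
    rcases Nat.eq_zero_or_pos j with rfl | h0
    · simp [coeffB_zero]
    · rw [coeffB_eq_sum j h0]
      push_cast
      refine IsUltrametricDist.norm_sum_le_of_forall_le_of_nonneg zero_le_one fun k hk => ?_
      rw [Finset.mem_Icc] at hk
      rw [norm_mul]
      exact mul_le_one₀ (padic_norm_coeffb_le_one (by omega)) (norm_nonneg _)
        (ih _ (by omega) (by omega))

theorem PadicInt.dvd_pow_sub_self (x : ℤ_[p]) : (p : ℤ_[p]) ∣ x ^ p - x := by
  rw [← Ideal.mem_span_singleton, ← PadicInt.maximalIdeal_eq_span_p, ← PadicInt.ker_toZMod,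
    RingHom.mem_ker, map_sub, map_pow, ZMod.pow_card, sub_self]

theorem PadicInt.dvd_choose_pred_sub {j : ℕ} (hj : j < p) :
    (p : ℤ_[p]) ∣ ((p - 1).choose j : ℤ_[p]) - (-1) ^ j := by
  have hp : p.Prime := Fact.out
  induction j with
  | zero => simp
  | succ j ih =>
    have h : (p : ℤ_[p]) ∣ (p.choose (j + 1) : ℤ_[p]) := by
      exact_mod_cast Nat.cast_dvd_cast (hp.dvd_choose_self (by omega) hj)
    have h2 : p.choose (j + 1) = (p - 1).choose j + (p - 1).choose (j + 1) := by
      conv_lhs => rw [← Nat.sub_add_cancel hp.one_le]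
      exact Nat.choose_succ_succ _ _
    have := dvd_sub h (ih (by omega))
    convert this using 1
    rw [h2]
    push_cast
    ring

/-- Multiplied by the unit `j + 1`, the two terms become `(p - 1).choose j` and `(-1) ^ j`. -/
theorem PadicInt.dvd_choose_div_sub {j : ℕ} (hj : j < p - 1) (a : ℤ_[p])
    (ha : (a : ℚ_[p]) = -((coeffb j : ℚ) : ℚ_[p])) :
    (p : ℤ_[p]) ∣ ((p.choose (j + 1) / p : ℕ) : ℤ_[p]) - a := by
  have hp : p.Prime := Fact.out
  have h1 : ((j + 1 : ℕ) : ℤ_[p]) * a = (-1) ^ j := by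
    apply Subtype.coe_injective
    have : ((j : ℚ_[p]) + 1) ≠ 0 := by exact_mod_cast Nat.succ_ne_zero j
    push_cast
    rw [ha, coeffb]
    push_cast
    field_simp
    ring
  have h2 : (j + 1) * (p.choose (j + 1) / p) = (p - 1).choose j := by
    apply Nat.eq_of_mul_eq_mul_left hp.pos
    have h3 := Nat.add_one_mul_choose_eq (p - 1) j
    rw [Nat.sub_add_cancel hp.one_le] at h3
    rw [h3, mul_left_comm, Nat.mul_div_cancel' (hp.dvd_choose_self (by omega) (by omega)),
      mul_comm]
  have h4 : (p : ℤ_[p]) ∣ ((j + 1 : ℕ) : ℤ_[p]) *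
      (((p.choose (j + 1) / p : ℕ) : ℤ_[p]) - a) := by
    rw [mul_sub, h1, ← Nat.cast_mul, h2]
    exact PadicInt.dvd_choose_pred_sub (by omega)
  refine (PadicInt.prime_p.dvd_or_dvd h4).resolve_left fun h => ?_
  have : ‖((j + 1 : ℕ) : ℤ_[p])‖ = 1 := by
    rw [PadicInt.norm_natCast_eq_one_iff]
    exact Nat.coprime_of_lt_prime (by omega) (by omega) Fact.out
  rw [← PadicInt.isUnit_iff] at this
  exact PadicInt.prime_p.not_isUnit (isUnit_of_dvd_unit h this)

/-- The `p`-integral coefficients, as sequences of `p`-adic integers. -/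
theorem exists_padicInt_coeff (p : ℕ) [Fact p.Prime] : ∃ a b : ℕ → ℤ_[p],
    (∀ j < p - 1, (b j : ℚ_[p]) = ((coeffB j : ℚ) : ℚ_[p])) ∧
    (∀ d < p - 1, ∑ ij ∈ Finset.HasAntidiagonal.antidiagonal d, a ij.1 * b ij.2 =
      if d = 0 then 1 else 0) ∧
    (∀ j < p - 1, (p : ℤ_[p]) ∣ ((p.choose (j + 1) / p : ℕ) : ℤ_[p]) - a j) := by
  classical
  have ha : ∃ a : ℕ → ℤ_[p], ∀ j < p - 1, (a j : ℚ_[p]) = -((coeffb j : ℚ) : ℚ_[p]) :=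
    -- `coeffb (p - 1)` has denominator `p`; the value `0` from there on is never used.
    ⟨fun j => if h : j < p - 1 then ⟨-((coeffb j : ℚ) : ℚ_[p]), by
      rw [norm_neg]; exact padic_norm_coeffb_le_one h⟩ else 0, fun j hj => by simp [hj]⟩
  have hb : ∃ b : ℕ → ℤ_[p], ∀ j < p - 1, (b j : ℚ_[p]) = ((coeffB j : ℚ) : ℚ_[p]) :=
    ⟨fun j => if h : j < p - 1 then ⟨((coeffB j : ℚ) : ℚ_[p]),
      padic_norm_coeffB_le_one h⟩ else 0, fun j hj => by simp [hj]⟩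
  obtain ⟨a, ha⟩ := ha
  obtain ⟨b, hb⟩ := hb
  refine ⟨a, b, hb, fun d hd => ?_, fun j hj => PadicInt.dvd_choose_div_sub hj _ (ha j hj)⟩
  apply Subtype.coe_injective
  have h := congrArg (fun q : ℚ => (q : ℚ_[p])) (sum_antidiagonal_neg_coeffb_mul_coeffB d)
  simp only [Rat.cast_sum, Rat.cast_mul, Rat.cast_neg] at h
  change PadicInt.Coe.ringHom _ = PadicInt.Coe.ringHom _
  rw [map_sum]
  trans (((if d = 0 then 1 else 0 : ℚ)) : ℚ_[p])
  · rw [← h]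
    refine Finset.sum_congr rfl fun ij hij => ?_
    rw [Finset.HasAntidiagonal.mem_antidiagonal] at hij
    rw [map_mul]
    change (a ij.1 : ℚ_[p]) * (b ij.2 : ℚ_[p]) = _
    rw [ha _ (by omega), hb _ (by omega)]
  · split_ifs <;> simp

end

/-! ### Norms in the algebraic closure. -/

theorem norm_add_eq_left_of_norm_lt {E : Type*} [SeminormedAddCommGroup E] [IsUltrametricDist E]
    {x e : E} (h : ‖e‖ < ‖x‖) : ‖x + e‖ = ‖x‖ := by
  rw [IsUltrametricDist.norm_add_eq_max_of_norm_ne_norm h.ne', max_eq_left h.le]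

theorem map_reducedBinomialSum {R S : Type*} [CommRing R] [CommRing S] (f : R →+* S) (p : ℕ)
    (x : R) : f (reducedBinomialSum p x) = reducedBinomialSum p (f x) := by
  simp [reducedBinomialSum]

namespace PadicAlgCl

variable {p : ℕ} [Fact p.Prime]

theorem norm_natCast_p (p : ℕ) [Fact p.Prime] : ‖(p : PadicAlgCl p)‖ = (p : ℝ)⁻¹ := by
  rw [← valuation_coe, valuation_p]
  simp

variable (p) in
/-- The ring of integers of `PadicAlgCl p`. -/
noncomputable abbrev integerRing : Subring (PadicAlgCl p) := (Valued.v : Valuation (PadicAlgCl p) ℝ≥0).integer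

theorem mem_integerRing {x : PadicAlgCl p} : x ∈ integerRing p ↔ ‖x‖ ≤ 1 := by
  rw [Valuation.mem_integer_iff, valuation_def, ← NNReal.coe_le_coe]
  simp

theorem norm_integerRing_le_one (x : integerRing p) : ‖(x : PadicAlgCl p)‖ ≤ 1 :=
  mem_integerRing.mp x.2

theorem integerRing_dvd_of_norm_le {x y : integerRing p}
    (h : ‖(y : PadicAlgCl p)‖ ≤ ‖(x : PadicAlgCl p)‖) : x ∣ y := by
  by_cases hx : (x : PadicAlgCl p) = 0
  · rw [hx, norm_zero, norm_le_zero_iff] at h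
    rw [Subtype.ext (h.trans hx.symm)]
  · refine ⟨⟨y / x, mem_integerRing.mpr ?_⟩, Subtype.ext ?_⟩
    · rw [norm_div]
      exact div_le_one_of_le₀ h (norm_nonneg _)
    · simp [mul_div_cancel₀ _ hx]

variable (p) in
/-- The inclusion of `ℤ_[p]` in the ring of integers of `PadicAlgCl p`. -/
noncomputable def ofPadicInt : ℤ_[p] →+* integerRing p :=
  ((algebraMap ℚ_[p] (PadicAlgCl p)).comp PadicInt.Coe.ringHom).codRestrict _ fun x => by
    rw [mem_integerRing]
    change ‖algebraMap ℚ_[p] (PadicAlgCl p) (x : ℚ_[p])‖ ≤ 1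
    simpa using x.2

theorem coe_ofPadicInt (x : ℤ_[p]) :
    (ofPadicInt p x : PadicAlgCl p) = algebraMap ℚ_[p] (PadicAlgCl p) x := rfl

theorem norm_reducedBinomialSum_sub_one_le {x : PadicAlgCl p} (hx : ‖x‖ ≤ 1) :
    ‖reducedBinomialSum p x - 1‖ ≤ ‖x‖ := by
  obtain ⟨v, hv⟩ := (Fact.out : p.Prime).dvd_reducedBinomialSum_sub_one
    (⟨x, mem_integerRing.mpr hx⟩ : integerRing p)
  have h := congrArg (integerRing p).subtype hv
  rw [map_sub, map_one, map_mul, map_reducedBinomialSum] at h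
  change reducedBinomialSum p x - 1 = x * v at h
  rw [h, norm_mul]
  exact mul_le_of_le_one_right (norm_nonneg _) (norm_integerRing_le_one v)

theorem norm_reducedBinomialSum {x : PadicAlgCl p} (hx : ‖x‖ < 1) :
    ‖reducedBinomialSum p x‖ = 1 := by
  have h := norm_reducedBinomialSum_sub_one_le hx.le
  rw [← add_sub_cancel 1 (reducedBinomialSum p x), norm_add_eq_left_of_norm_lt, norm_one]
  rw [norm_one]
  exact h.trans_lt hx

theorem norm_reducedBinomialSum_le_one {x : PadicAlgCl p} (hx : ‖x‖ ≤ 1) :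
    ‖reducedBinomialSum p x‖ ≤ 1 := by
  have h := (norm_reducedBinomialSum_sub_one_le hx).trans hx
  rw [← add_sub_cancel 1 (reducedBinomialSum p x)]
  exact (IsUltrametricDist.norm_add_le_max _ _).trans (max_le norm_one.le h)

theorem norm_sub_one_le_of_pow_eq_one {x : PadicAlgCl p} {n : ℕ} (hn : n ≠ 0) (hx : x ^ n = 1) :
    ‖x - 1‖ ≤ 1 := by
  have h : ‖x‖ = 1 := by
    rw [← pow_eq_one_iff_of_nonneg (norm_nonneg x) hn, ← norm_pow, hx, norm_one]
  rw [sub_eq_add_neg]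
  exact (IsUltrametricDist.norm_add_le_max _ _).trans (by simp [h])

theorem inv_p_lt_one (p : ℕ) [Fact p.Prime] : ((p : ℝ)⁻¹) < 1 :=
  inv_lt_one_of_one_lt₀ (by exact_mod_cast (Fact.out : p.Prime).one_lt)

/-- The norm of `ζ_p - 1`. -/
theorem norm_pow_of_isPrimitiveRoot_prime {ζ : PadicAlgCl p} (hζ : IsPrimitiveRoot ζ p) :
    ‖ζ - 1‖ < 1 ∧ ‖ζ - 1‖ ^ (p - 1) = (p : ℝ)⁻¹ := by
  have hp : p.Prime := Fact.out
  have hle := norm_sub_one_le_of_pow_eq_one hp.ne_zero hζ.pow_eq_one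
  have h := hp.pow_pred_eq_of_one_add_pow_eq_one (l := ζ - 1)
    (sub_ne_zero.mpr (hζ.ne_one hp.one_lt)) (by rw [add_sub_cancel, hζ.pow_eq_one])
  have hn := congrArg norm h
  rw [norm_pow, norm_neg, norm_mul, norm_natCast_p] at hn
  have hlt : ‖ζ - 1‖ < 1 := by
    rw [← pow_lt_one_iff_of_nonneg (norm_nonneg _) (Nat.sub_ne_zero_of_lt hp.one_lt), hn]
    exact (mul_le_of_le_one_right (by positivity) (norm_reducedBinomialSum_le_one hle)).trans_lt
      (inv_p_lt_one p)
  exact ⟨hlt, by rw [hn, norm_reducedBinomialSum hlt, mul_one]⟩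

/-- The norm of `ζ_{p²} - 1`. -/
theorem norm_pow_of_isPrimitiveRoot_prime_sq {ζ : PadicAlgCl p} (hζ : IsPrimitiveRoot ζ (p ^ 2)) :
    ‖ζ - 1‖ < 1 ∧ ‖ζ - 1‖ ^ (p * (p - 1)) = (p : ℝ)⁻¹ := by
  have hp : p.Prime := Fact.out
  have hle := norm_sub_one_le_of_pow_eq_one (pow_ne_zero 2 hp.ne_zero) hζ.pow_eq_one
  obtain ⟨h1, h2⟩ := norm_pow_of_isPrimitiveRoot_prime
    (hζ.pow (pow_pos hp.pos 2) (sq p))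
  have h := hp.one_add_pow_eq_reducedBinomialSum (ζ - 1)
  rw [add_sub_cancel] at h
  have hexp : (ζ - 1) ^ p = (ζ ^ p - 1) + -(p * (ζ - 1) * reducedBinomialSum p (ζ - 1)) := by
    linear_combination -h
  have herr : ‖-(p * (ζ - 1) * reducedBinomialSum p (ζ - 1))‖ ≤ (p : ℝ)⁻¹ * ‖ζ - 1‖ := by
    rw [norm_neg, norm_mul, norm_mul, norm_natCast_p]
    exact mul_le_of_le_one_right (by positivity) (norm_reducedBinomialSum_le_one hle)
  have hlt : ‖ζ - 1‖ < 1 := by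
    rw [← pow_lt_one_iff_of_nonneg (norm_nonneg _) hp.ne_zero, ← norm_pow, hexp]
    refine (IsUltrametricDist.norm_add_le_max _ _).trans_lt (max_lt h1 (herr.trans_lt ?_))
    exact (mul_le_of_le_one_right (by positivity) hle).trans_lt (inv_p_lt_one p)
  have hpos : (0 : ℝ) < (p : ℝ)⁻¹ := inv_pos.mpr (by exact_mod_cast hp.pos)
  -- The error is smaller than `‖p‖ = ‖ζ ^ p - 1‖ ^ (p - 1)`, so `ζ ^ p - 1` dominates.
  have herr2 : ‖-(p * (ζ - 1) * reducedBinomialSum p (ζ - 1))‖ < ‖ζ ^ p - 1‖ := by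
    refine herr.trans_lt ((mul_lt_of_lt_one_right hpos hlt).trans_le ?_)
    rw [← h2]
    exact pow_le_of_le_one (norm_nonneg _) h1.le (Nat.sub_ne_zero_of_lt hp.one_lt)
  refine ⟨hlt, ?_⟩
  rw [pow_mul, ← norm_pow, hexp, norm_add_eq_left_of_norm_lt herr2, h2]

/-- The norm of the element of the main theorem. -/
theorem norm_pow_uniformizer (hp3 : 2 < p) {ζ : PadicAlgCl p} (hζ : IsPrimitiveRoot ζ (p ^ 2))
    {α : PadicAlgCl p} (hα : α ^ p = (p : PadicAlgCl p)) :
    ‖(ζ - 1) ^ (-2 * (p : ℤ) + 3) *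
        (α + ∑ t ∈ Finset.range (p - 1),
          (coeffB t : PadicAlgCl p) * (ζ - 1) ^ (t + p - 1))‖ ^ p = ‖ζ - 1‖ := by
  have hp : p.Prime := Fact.out
  obtain ⟨hr1, hr⟩ := norm_pow_of_isPrimitiveRoot_prime_sq hζ
  obtain ⟨a, b, hb, hab, ha⟩ := exists_padicInt_coeff p
  have hπ0 : ζ - 1 ≠ 0 :=
    sub_ne_zero.mpr (hζ.ne_one (one_lt_pow₀ hp.one_lt two_ne_zero))
  obtain ⟨π, hπ⟩ : ∃ π : integerRing p, (π : PadicAlgCl p) = ζ - 1 :=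
    ⟨⟨ζ - 1, mem_integerRing.mpr hr1.le⟩, rfl⟩
  have hpos : 0 < ‖ζ - 1‖ := norm_pos_iff.mpr hπ0
  have hb0 : b 0 = 1 := by
    apply Subtype.coe_injective
    exact (hb 0 (by omega)).trans (by simp [coeffB_zero])
  obtain ⟨s, u, hsu⟩ := exists_add_pow_eq_of_convolution_inverse hp hp3 π
    (fun j => ofPadicInt p (a j)) (fun j => ofPadicInt p (b j))
    (fun d hd => by
      have := congrArg (ofPadicInt p) (hab d hd)
      rw [map_sum] at this
      simp only [map_mul] at this
      rw [this]
      split_ifs <;> simp)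
    (fun j hj => by simpa using map_dvd (ofPadicInt p) (ha j hj))
    (fun j _ => by simpa using map_dvd (ofPadicInt p) (PadicInt.dvd_pow_sub_self (b j)))
    (by simp only [hb0, map_one])
    (integerRing_dvd_of_norm_le (by
      push_cast
      rw [hπ, norm_natCast_p, norm_pow, hr]))
    (fun h => by
      have := congrArg (Subtype.val) h
      push_cast at this
      rw [hπ, add_sub_cancel] at this
      exact hζ.pow_ne_one_of_pos_of_lt hp.ne_zero (by nlinarith) this)
    (Subtype.ext (by push_cast; rw [hπ, add_sub_cancel, hζ.pow_eq_one]))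
  obtain ⟨S, hS⟩ : ∃ S, S = ∑ t ∈ Finset.range (p - 1), ofPadicInt p (b t) * π ^ t := ⟨_, rfl⟩
  rw [← hS] at hsu
  have hsum : ∑ t ∈ Finset.range (p - 1), (coeffB t : PadicAlgCl p) * (ζ - 1) ^ (t + p - 1) =
      (ζ - 1) ^ (p - 1) * S := by
    rw [hS, ← hπ]
    push_cast
    rw [Finset.mul_sum]
    refine Finset.sum_congr rfl fun t ht => ?_
    rw [coe_ofPadicInt, hb t (Finset.mem_range.mp ht), map_ratCast,
      show t + p - 1 = (p - 1) + t by omega, pow_add]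
    ring
  have hαn : ‖α‖ = ‖ζ - 1‖ ^ (p - 1) := by
    rw [← pow_left_inj₀ (norm_nonneg _) (by positivity) hp.ne_zero, ← norm_pow, hα,
      norm_natCast_p, ← hr, ← pow_mul, mul_comm]
  obtain ⟨γ, hγ⟩ : ∃ γ : integerRing p, α = (ζ - 1) ^ (p - 1) * γ :=
    ⟨⟨α / (ζ - 1) ^ (p - 1), mem_integerRing.mpr (by
      rw [norm_div, hαn, norm_pow, div_self (by positivity)])⟩, by
      rw [mul_div_cancel₀ _ (pow_ne_zero _ hπ0)]⟩
  obtain ⟨w, hw⟩ : ∃ w : integerRing p, w = γ + S := ⟨_, rfl⟩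
  have hsum2 : ‖((γ ^ p + S ^ p : integerRing p) : PadicAlgCl p)‖ =
      ‖ζ - 1‖ ^ (p * (p - 2) + 1) := by
    have e := congrArg (Subtype.val) hsu
    push_cast at e ⊢
    rw [hπ] at e
    have e1 : (p : PadicAlgCl p) + ((ζ - 1) ^ (p - 1) * (S : PadicAlgCl p)) ^ p =
        (ζ - 1) ^ (p * (p - 1)) * (γ ^ p + S ^ p) := by
      rw [← hα, hγ, mul_pow, mul_pow, ← pow_mul, mul_comm (p - 1) p]
      ring
    rw [e1] at e
    have e2 : ‖(1 : PadicAlgCl p) + (ζ - 1) * u‖ = 1 := by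
      rw [norm_add_eq_left_of_norm_lt, norm_one]
      rw [norm_mul, norm_one]
      exact (mul_le_of_le_one_right (norm_nonneg _) (norm_integerRing_le_one u)).trans_lt hr1
    have e3 : ‖(p : PadicAlgCl p) * (ζ - 1) ^ (p * (p - 2) + 1) * (1 + (ζ - 1) * u)‖ =
        ‖ζ - 1‖ ^ (p * (p - 1)) * ‖ζ - 1‖ ^ (p * (p - 2) + 1) := by
      rw [norm_mul, norm_mul, e2, mul_one, norm_natCast_p, ← hr, norm_pow]
    have e4 : ‖(p : PadicAlgCl p) ^ 2 * (s : PadicAlgCl p)‖ <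
        ‖ζ - 1‖ ^ (p * (p - 1)) * ‖ζ - 1‖ ^ (p * (p - 2) + 1) := by
      rw [norm_mul, norm_pow, norm_natCast_p, ← hr, sq, mul_assoc]
      refine mul_lt_mul_of_pos_left ?_ (by positivity)
      refine (mul_le_of_le_one_right (by positivity) (norm_integerRing_le_one s)).trans_lt ?_
      refine pow_lt_pow_right_of_lt_one₀ hpos hr1 ?_
      obtain ⟨m, rfl⟩ : ∃ m, p = m + 3 := ⟨p - 3, by omega⟩
      rw [show m + 3 - 2 = m + 1 by omega, show m + 3 - 1 = m + 2 by omega]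
      nlinarith
    have e5 := congrArg norm e
    rw [norm_add_eq_left_of_norm_lt (by rw [e3]; exact e4), e3, norm_mul, norm_pow] at e5
    exact mul_left_cancel₀ (by positivity) e5
  have hwn : ‖(w : PadicAlgCl p)‖ ^ p = ‖ζ - 1‖ ^ (p * (p - 2) + 1) := by
    -- `w - S = γ` and `p` is odd, so `w ^ p ≡ γ ^ p + S ^ p` modulo `p`; the error is negligible
    -- because `p (p - 1) > p (p - 2) + 1`.
    obtain ⟨t, ht⟩ := exists_add_pow_prime_eq hp w (-S)
    rw [(hp.odd_of_ne_two (by omega)).neg_pow, hw, add_neg_cancel_right, ← hw] at ht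
    have e : w ^ p = (γ ^ p + S ^ p) + -(p * (w * (-S) * t)) := by
      linear_combination -ht
    have e1 : ‖((p * (w * (-S) * t) : integerRing p) : PadicAlgCl p)‖ ≤
        ‖ζ - 1‖ ^ (p * (p - 1)) := by
      rw [Subring.coe_mul, norm_mul, hr, Subring.coe_natCast, norm_natCast_p]
      exact mul_le_of_le_one_right (by positivity) (norm_integerRing_le_one _)
    rw [← norm_pow, ← Subring.coe_pow, e, Subring.coe_add, norm_add_eq_left_of_norm_lt, hsum2]
    rw [hsum2, Subring.coe_neg, norm_neg]
    refine e1.trans_lt (pow_lt_pow_right_of_lt_one₀ hpos hr1 ?_)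
    obtain ⟨m, rfl⟩ : ∃ m, p = m + 3 := ⟨p - 3, by omega⟩
    rw [show m + 3 - 2 = m + 1 by omega, show m + 3 - 1 = m + 2 by omega]
    nlinarith
  rw [hsum, hγ, ← mul_add, ← Subring.coe_add, ← hw, norm_mul, norm_mul, norm_zpow, norm_pow,
    mul_pow, mul_pow, hwn]
  simp only [← zpow_natCast, ← zpow_mul]
  -- The exponents add up to `p (-2 p + 3) + p (p - 1) + p (p - 2) + 1 = 1`.
  rw [← zpow_add₀ hpos.ne', ← zpow_add₀ hpos.ne']
  conv_rhs => rw [← zpow_one ‖ζ - 1‖]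
  congr 1
  push_cast [Nat.cast_sub hp.one_le, Nat.cast_sub hp3.le]
  ring

end PadicAlgCl

/-! ### Degrees and value groups. -/

namespace PadicAlgCl

variable {p : ℕ} [Fact p.Prime]

/-- The norm is the spectral norm, so this power is the norm of the constant coefficient of the
minimal polynomial. -/
theorem exists_norm_pow_natDegree_minpoly_eq_zpow {y : PadicAlgCl p} (hy : y ≠ 0) :
    ∃ k : ℤ, ‖y‖ ^ (minpoly ℚ_[p] y).natDegree = ((p : ℝ)⁻¹) ^ k := by
  have hint : IsIntegral ℚ_[p] y := Algebra.IsIntegral.isIntegral y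
  have h := spectralNorm.spectralNorm_eq_norm_coeff_zero_rpow ℚ_[p] (PadicAlgCl p) y
  rw [spectralNorm_eq] at h
  refine ⟨((minpoly ℚ_[p] y).coeff 0).valuation, ?_⟩
  rw [h, one_div, Real.rpow_inv_natCast_pow (norm_nonneg _) (minpoly.natDegree_pos hint).ne',
    Padic.norm_eq_zpow_neg_valuation (minpoly.coeff_zero_ne_zero hint hy), inv_zpow, zpow_neg]

theorem inv_p_zpow_injective (p : ℕ) [Fact p.Prime] :
    Function.Injective fun k : ℤ => ((p : ℝ)⁻¹) ^ k :=
  zpow_right_injective₀ (inv_pos.mpr (by exact_mod_cast (Fact.out : p.Prime).pos))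
    (inv_p_lt_one p).ne

/-- In a field of degree at most `n` over `ℚ_[p]`, an element of norm `p ^ (-1 / n)` generates
the value group. -/
theorem exists_norm_eq_zpow_of_finrank_le (K : IntermediateField ℚ_[p] (PadicAlgCl p))
    [FiniteDimensional ℚ_[p] K] {n : ℕ} (hn : n ≠ 0) (hK : Module.finrank ℚ_[p] K ≤ n)
    {x : PadicAlgCl p} (hx : x ∈ K) (hxn : ‖x‖ ^ n = (p : ℝ)⁻¹)
    {y : PadicAlgCl p} (hy : y ∈ K) (hy0 : y ≠ 0) : ∃ k : ℤ, ‖y‖ = ‖x‖ ^ k := by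
  have hp : (0 : ℝ) < (p : ℝ)⁻¹ := inv_pos.mpr (by exact_mod_cast (Fact.out : p.Prime).pos)
  have hx0 : x ≠ 0 := by
    rintro rfl
    rw [norm_zero, zero_pow hn] at hxn
    exact hp.ne hxn
  have hdvd : ∀ z ∈ K, (minpoly ℚ_[p] z).natDegree ∣ Module.finrank ℚ_[p] K := fun z hz => by
    have := minpoly.degree_dvd (Algebra.IsIntegral.isIntegral (R := ℚ_[p]) (⟨z, hz⟩ : K))
    rwa [IntermediateField.minpoly_eq] at this
  -- The norm of `x` forces `n` to divide the degree of `x`: `K` is totally ramified of degree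
  -- exactly `n`.
  have hfin : Module.finrank ℚ_[p] K = n := by
    obtain ⟨k, hk⟩ := exists_norm_pow_natDegree_minpoly_eq_zpow hx0
    have h1 : ((p : ℝ)⁻¹) ^ ((minpoly ℚ_[p] x).natDegree : ℤ) = ((p : ℝ)⁻¹) ^ (k * n) := by
      rw [zpow_mul, ← hk, ← hxn, zpow_natCast, zpow_natCast, ← pow_mul, ← pow_mul, mul_comm]
    have h2 : n ∣ (minpoly ℚ_[p] x).natDegree := by
      rw [← Int.natCast_dvd_natCast]
      exact ⟨k, (inv_p_zpow_injective p h1).trans (mul_comm _ _)⟩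
    exact le_antisymm hK (Nat.le_of_dvd Module.finrank_pos (h2.trans (hdvd x hx)))
  obtain ⟨k, hk⟩ := exists_norm_pow_natDegree_minpoly_eq_zpow hy0
  obtain ⟨e, he⟩ := hdvd y hy
  rw [hfin] at he
  refine ⟨k * e, (pow_left_inj₀ (norm_nonneg _) (zpow_nonneg (norm_nonneg _) _) hn).mp ?_⟩
  rw [← zpow_natCast (‖x‖ ^ _), zpow_comm, zpow_natCast, hxn, zpow_mul, ← hk, zpow_natCast,
    ← pow_mul, ← he]

theorem isUniformizerOf_of_norm_pow_eq (K : IntermediateField ℚ_[p] (PadicAlgCl p))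
    [FiniteDimensional ℚ_[p] K] {n : ℕ} (hn : n ≠ 0) (hK : Module.finrank ℚ_[p] K ≤ n)
    {x : PadicAlgCl p} (hx : x ∈ K) (hxn : ‖x‖ ^ n = (p : ℝ)⁻¹) : IsUniformizerOf K x := by
  have hlt : ‖x‖ < 1 := by
    rw [← pow_lt_one_iff_of_nonneg (norm_nonneg _) hn, hxn]
    exact inv_p_lt_one p
  have hx0 : ‖x‖₊ ≠ 0 := by
    intro h
    rw [nnnorm_eq_zero] at h
    rw [h, norm_zero, zero_pow hn, eq_comm, inv_eq_zero] at hxn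
    exact (Fact.out : p.Prime).ne_zero (by exact_mod_cast hxn)
  have hval : ∀ y : K, padicValuationOn K y = ‖(y : PadicAlgCl p)‖₊ := fun y => rfl
  have hg : Subgroup.zpowers (Units.mk0 ‖x‖₊ hx0) =
      MonoidWithZeroHom.valueGroup (.ofClass (padicValuationOn K)) := by
    apply le_antisymm
    · rw [Subgroup.zpowers_le]
      exact MonoidWithZeroHom.mem_valueGroup _ ⟨⟨x, hx⟩, rfl⟩
    · rw [MonoidWithZeroHom.valueGroup_def, Subgroup.closure_le]
      rintro b ⟨y, hy⟩
      have hyb : ‖(y : PadicAlgCl p)‖₊ = (b : ℝ≥0) := hy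
      have hy0 : (y : PadicAlgCl p) ≠ 0 := by
        intro h
        rw [h, nnnorm_zero] at hyb
        exact b.ne_zero hyb.symm
      obtain ⟨k, hk⟩ := exists_norm_eq_zpow_of_finrank_le K hn hK hx hxn y.2 hy0
      refine ⟨k, Units.ext ?_⟩
      rw [← hyb]
      apply NNReal.coe_injective
      simp [hk]
  have hlt' : Units.mk0 ‖x‖₊ hx0 < 1 := by
    rw [← Units.val_lt_val]
    exact hlt
  have hd : (padicValuationOn K).IsRankOneDiscrete := ⟨⟨_, hg, hlt'⟩⟩
  refine ⟨hx, hd, ?_⟩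
  rw [Valuation.IsUniformizer.iff, hval,
    ← Valuation.IsRankOneDiscrete.valueGroup_genLTOne_eq_generator,
    ← LinearOrderedCommGroup.Subgroup.genLTOne_unique _ hlt' hg]
  rfl

theorem finrank_adjoin_le_natDegree {y : PadicAlgCl p} {f : Polynomial ℚ_[p]} (hf : f ≠ 0)
    (hy : Polynomial.aeval y f = 0) :
    Module.finrank ℚ_[p] (IntermediateField.adjoin ℚ_[p] {y}) ≤ f.natDegree := by
  rw [IntermediateField.adjoin.finrank (Algebra.IsIntegral.isIntegral y)]
  exact Polynomial.natDegree_le_of_dvd (minpoly.dvd _ _ hy) hf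

/-- An upper bound suffices; equality follows from the existence of an element of norm `p ^ (-1 /
n)`. -/
theorem finrank_adjoin_pair_le {ζ : PadicAlgCl p} (hζ : IsPrimitiveRoot ζ (p ^ 2))
    {α : PadicAlgCl p} (hα : α ^ p = (p : PadicAlgCl p)) :
    Module.finrank ℚ_[p] (IntermediateField.adjoin ℚ_[p] {ζ, α}) ≤ p * (p * (p - 1)) := by
  have hp : p.Prime := Fact.out
  rw [Set.insert_eq, IntermediateField.adjoin_union, mul_comm]
  refine (IntermediateField.finrank_sup_le _ _).trans (Nat.mul_le_mul ?_ ?_)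
  · refine (finrank_adjoin_le_natDegree (Polynomial.cyclotomic_ne_zero (p ^ 2) ℚ_[p]) ?_).trans ?_
    · rw [Polynomial.aeval_def, Polynomial.eval₂_eq_eval_map, Polynomial.map_cyclotomic]
      exact hζ.isRoot_cyclotomic (pow_pos hp.pos 2)
    · rw [Polynomial.natDegree_cyclotomic, Nat.totient_prime_pow hp two_pos]
      simp
  · refine (finrank_adjoin_le_natDegree
      (Polynomial.X_pow_sub_C_ne_zero hp.pos (p : ℚ_[p])) ?_).trans ?_
    · simp [hα]
    · rw [Polynomial.natDegree_X_pow_sub_C]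

end PadicAlgCl

theorem mainTheorem2 (p : ℕ) [Fact p.Prime] (hp : Odd p)
    (ζ : PadicAlgCl p) (hζ : IsPrimitiveRoot ζ (p ^ 2))
    (α : PadicAlgCl p) (hα : α ^ p = (p : PadicAlgCl p)) :
    IsUniformizerOf (IntermediateField.adjoin ℚ_[p] {ζ, α})
      ((ζ - 1) ^ (-2 * (p : ℤ) + 3) *
        (α + ∑ t ∈ Finset.range (p - 1),
          (coeffB t : PadicAlgCl p) * (ζ - 1) ^ (t + p - 1))) := by
  have hpp : p.Prime := Fact.out
  have hp3 : 2 < p := by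
    rcases hpp.two_le.eq_or_lt with h | h
    · subst h
      exact absurd hp (by decide)
    · exact h
  have : FiniteDimensional ℚ_[p] (IntermediateField.adjoin ℚ_[p] {ζ, α}) :=
    IntermediateField.finiteDimensional_adjoin fun _ _ => Algebra.IsIntegral.isIntegral _
  have hζK : ζ ∈ IntermediateField.adjoin ℚ_[p] {ζ, α} :=
    IntermediateField.subset_adjoin _ _ (by simp)
  have hαK : α ∈ IntermediateField.adjoin ℚ_[p] {ζ, α} :=
    IntermediateField.subset_adjoin _ _ (by simp)
  have hπK := sub_mem hζK (one_mem _)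
  refine PadicAlgCl.isUniformizerOf_of_norm_pow_eq _ (n := p * (p * (p - 1))) ?_
    (PadicAlgCl.finrank_adjoin_pair_le hζ hα) ?_ ?_
  · exact mul_ne_zero hpp.ne_zero (mul_ne_zero hpp.ne_zero (by omega))
  · refine mul_mem (zpow_mem hπK _) (add_mem hαK (sum_mem fun t _ => mul_mem ?_ (pow_mem hπK _)))
    exact SubfieldClass.ratCast_mem _ _
  · rw [pow_mul, PadicAlgCl.norm_pow_uniformizer hp3 hζ hα]
    exact (PadicAlgCl.norm_pow_of_isPrimitiveRoot_prime_sq hζ).2
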